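/- Let $V$ be a finite non-empty set and let $p:V\times V\to[0,1]$ be an irreducible Markov chain on $V$, i.e. $\sum_{y}p(x,y)=1$ for every $x$ and any two states are joined by a sequence of transitions of positive probability. Assume that $p$ has symmetric support: $p(x,y)>0$ if and only if $p(y,x)>0$. The chain need not be reversible. Write $x\sim y$ if $x\ne y$ and $p(x,y)>0$, let $G$ be the resulting graph, $\deg(x)=|\{y:y\sim x\}|$, and $\deg_{\min}=\min_{x}\deg(x)$. Let $d:V\times V\to[0,\infty)$ be a general path distance on $G$: it is symmetric, $d(x,y)=0$ if and only if $x=y$, and $$d(x,y)=\inf\Big\{\sum_{k=1}^n d(x_{k-1},x_k): x=x_0\sim x_1\sim\dots\sim x_n=y\Big\}\qquad\text{for all }x,y\in V .$$ *Curvature.* For $f:V\to\mathbb R$ put $\Delta f(x)=\sum_y p(x,y)(f(y)-f(x))$, $\nabla_{xy}f=\frac{f(x)-f(y)}{d(x,y)}$ for $x\neq y$, and $\|\nabla f\|_\infty=\sup_{x\ne y}|\nabla_{xy}f|$. For $x\ne y$ the Ollivier curvature is $$\kappa(x,y)=\inf\{\nabla_{xy}\Delta f:\ \nabla_{yx}f=1,\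 \|\nabla f\|_\infty=1\}.$$ Non-negative Ollivier curvature means $\kappa(x,y)\ge 0$ for all $x\neq y$. *First Betti number.* Let $C(X_0)=\mathbb R^V$, and let $C(X_1)$ be the space of $1$-forms, i.e. of functions $\alpha(x,y)$ of pairs of vertices with $\alpha(x,y)=-\alpha(y,x)$ and $\alpha(x,y)=0$ unless $x\sim y$. Let $X_2$ be the set of all cycles $(x_0\sim x_1\sim\dots\sim x_{n-1})$, $x_{n-1}\sim x_0$, with $n\ge 3$ distinct vertices (considered up to rotation and reflection) such that, for a suitable labelling, either $n=3$, or $d(x_0,x_3)<d(x_0,x_1)+d(x_1,x_2)+d(x_2,x_3)$ and $x_3\sim\dots\sim x_{n-1}\sim x_0$ is a geodesic, i.e. its $d$-length is $d(x_3,x_0)$. Let $M_2(G)$ be the $2$-dimensional cell complex with vertices $V$, the edges of $G$ and the $2$-cells $X_2$, with coboundaries $\delta_0f(x,y)=f(x)-f(y)$ for $x\sim y$, and $\delta_1\alpha(x_0\sim\dots\sim x_{n-1})=\sum_{i=0}^{n-1}\alpha(x_i,x_{i+1\bmod n})$. Define $$\beta_1(M_2(G))=\dim\big(\ker\delta_1/\operatorname{Im}\delta_0\big).$$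 **Theorem.** One has $\beta_1(M_2(G))=\dim H_1(M_2(G))$, where $$H_1(M_2(G))=\Big\{\alpha\in C(X_1):\ \delta_1\alpha=0,\ x\mapsto\sum_{y}p(x,y)\alpha(x,y)\text{ is constant on }V\Big\}.$$ Moreover, if $G$ has non-negative Ollivier curvature with respect to $d$, then $$\beta_1(M_2(G))\le\frac{\deg_{\min}}{2}.$$ -/

import Mathlib

noncomputable section

namespace OllivierBetti

/-- An irreducible, possibly non-reversible Markov chain with symmetric support on the finite
state space `V`. -/
structure MarkovChain (V : Type*) [Fintype V] where
  /-- the transition probability function -/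
  p : V → V → ℝ
  nonneg : ∀ x y, 0 ≤ p x y
  sum_eq_one : ∀ x, ∑ y, p x y = 1
  irreducible : ∀ x y, Relation.ReflTransGen (fun a b => 0 < p a b) x y
  symm_support : ∀ x y, 0 < p x y ↔ 0 < p y x

/-- The sum of `g a b` over the steps `a → b` of a walk. -/
def walkSum {V : Type*} {G : SimpleGraph V} (g : V → V → ℝ) {x y : V} (c : G.Walk x y) : ℝ :=
  (c.darts.map fun e => g e.fst e.snd).sum

/-- `d` is a general path distance on the graph `G`: a symmetric, non-negative function, zero
exactly on the diagonal, such that `d x y` is the infimum of the `d`-lengths of the paths from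
`x` to `y`. -/
structure IsPathDistance {V : Type*} (G : SimpleGraph V) (d : V → V → ℝ) : Prop where
  nonneg : ∀ x y, 0 ≤ d x y
  symm : ∀ x y, d x y = d y x
  eq_zero_iff : ∀ x y, d x y = 0 ↔ x = y
  isGLB : ∀ x y, IsGLB (Set.range fun c : G.Walk x y => walkSum d c) (d x y)

/-- The Lipschitz constant `‖∇f‖_∞ = sup_{x ≠ y} |f x - f y| / d x y` (the state space is finite
wherever this is used, so the supremum is over a bounded set). -/
def lipConst {V : Type*} (d : V → V → ℝ) (f : V → ℝ) : ℝ :=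
  sSup {r | ∃ x y, x ≠ y ∧ r = |(f x - f y) / d x y|}

/-- The space `C(X₁)` of one-forms on `G`: functions on oriented edges that change sign when the
orientation is reversed, extended by zero to pairs of vertices that are not adjacent. After fixing
an orientation of every edge these are the same as functions on the edges. -/
def oneForms {V : Type*} (G : SimpleGraph V) : Submodule ℝ (V → V → ℝ) where
  carrier := {α | (∀ x y, α x y = -α y x) ∧ ∀ x y, ¬ G.Adj x y → α x y = 0}
  zero_mem' := by simp
  add_mem' := by
    rintro α β ⟨ha, ha'⟩ ⟨hb, hb'⟩
    refine ⟨fun x y => ?_, fun x y h => ?_⟩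
    · simp only [Pi.add_apply]
      rw [ha x y, hb x y]
      ring
    · simp only [Pi.add_apply, ha' x y h, hb' x y h, add_zero]
  smul_mem' := by
    rintro c α ⟨ha, ha'⟩
    refine ⟨fun x y => ?_, fun x y h => ?_⟩
    · simp only [Pi.smul_apply, smul_eq_mul]
      rw [ha x y]
      ring
    · simp only [Pi.smul_apply, ha' x y h, smul_zero]

/-- The real vector space `C(X₁)` of one-forms, as a type. -/
def OneForm {V : Type*} (G : SimpleGraph V) : Type _ := oneForms G

instance {V : Type*} (G : SimpleGraph V) : AddCommGroup (OneForm G) :=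
  inferInstanceAs (AddCommGroup (oneForms G))

instance {V : Type*} (G : SimpleGraph V) : Module ℝ (OneForm G) :=
  inferInstanceAs (Module ℝ (oneForms G))

instance {V : Type*} (G : SimpleGraph V) : CoeFun (OneForm G) fun _ => V → V → ℝ :=
  ⟨fun α => α.1⟩

@[ext] theorem OneForm.ext {V : Type*} {G : SimpleGraph V} {α β : OneForm G}
    (h : ∀ x y, α x y = β x y) : α = β :=
  Subtype.ext (funext fun x => funext fun y => h x y)

@[simp] theorem OneForm.add_apply {V : Type*} {G : SimpleGraph V} (α β : OneForm G) (x y : V) :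
    (α + β) x y = α x y + β x y := rfl

@[simp] theorem OneForm.smul_apply {V : Type*} {G : SimpleGraph V} (r : ℝ) (α : OneForm G)
    (x y : V) : (r • α) x y = r * α x y := rfl

@[simp] theorem OneForm.zero_apply {V : Type*} {G : SimpleGraph V} (x y : V) :
    (0 : OneForm G) x y = 0 := rfl

/-- A closed walk `x₀ ∼ x₁ ∼ ⋯ ∼ xₙ₋₁ ∼ x₀` around a 2-cell: it is a cycle (in particular `n ≥ 3`
and `x₀, …, xₙ₋₁` are distinct), and either `n = 3`, or
`d x₀ x₃ < d x₀ x₁ + d x₁ x₂ + d x₂ x₃` and `x₃ ∼ ⋯ ∼ xₙ₋₁ ∼ x₀` is a geodesic. -/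
def IsTwoCell {V : Type*} {G : SimpleGraph V} (d : V → V → ℝ) {x : V} (c : G.Walk x x) : Prop :=
  c.IsCycle ∧
    (c.length = 3 ∨
      (d x (c.getVert 3) <
          d x (c.getVert 1) + d (c.getVert 1) (c.getVert 2) + d (c.getVert 2) (c.getVert 3) ∧
        walkSum d (c.drop 3) = d (c.getVert 3) x))

/-- The 2-cells `X₂`, each listed with all its admissible starting points and directions.
Two closed walks that differ by a rotation or a reversal represent the same 2-cell; on a one-form
the coboundary takes the same value on both up to sign, so that listing a 2-cell several times
does not affect the kernel of the coboundary. -/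
def TwoCell {V : Type*} (G : SimpleGraph V) (d : V → V → ℝ) : Type _ :=
  {c : Σ x : V, G.Walk x x // IsTwoCell d c.2}

open Classical in
/-- The one-form `δ f`: `δ f (x, y) = f x - f y` for `x ∼ y`. -/
def gradForm {V : Type*} (G : SimpleGraph V) (f : V → ℝ) : OneForm G :=
  ⟨fun x y => if G.Adj x y then f x - f y else 0, by
    refine ⟨fun x y => ?_, fun x y h => if_neg h⟩
    by_cases h : G.Adj x y
    · simp [h, h.symm]
    · simp [h, G.adj_comm y x]⟩

open Classical in
theorem gradForm_apply {V : Type*} (G : SimpleGraph V) (f : V → ℝ) (x y : V) :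
    gradForm G f x y = if G.Adj x y then f x - f y else 0 := rfl

/-- The coboundary `δ₀ : C(X₀) → C(X₁)`. -/
def delta0 {V : Type*} (G : SimpleGraph V) : (V → ℝ) →ₗ[ℝ] OneForm G where
  toFun f := gradForm G f
  map_add' f g := by
    ext x y
    simp only [OneForm.add_apply, gradForm_apply, Pi.add_apply]
    split_ifs <;> ring
  map_smul' c f := by
    ext x y
    simp only [OneForm.smul_apply, gradForm_apply, Pi.smul_apply, smul_eq_mul, RingHom.id_apply]
    split_ifs <;> ring

/-- The coboundary `δ₁ : C(X₁) → C(X₂)`, the sum of a one-form around a 2-cell. -/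
def delta1 {V : Type*} (G : SimpleGraph V) (d : V → V → ℝ) :
    OneForm G →ₗ[ℝ] (TwoCell G d → ℝ) where
  toFun α c := walkSum α c.1.2
  map_add' α β := by
    ext c
    simp [walkSum, List.sum_map_add]
  map_smul' r α := by
    ext c
    simp [walkSum, List.sum_map_mul_left]

/-- `δ₁ ∘ δ₀ = 0`, so that `Im δ₀ ≤ ker δ₁`. -/
theorem delta1_delta0 {V : Type*} (G : SimpleGraph V) (d : V → V → ℝ) (f : V → ℝ) :
    delta1 G d (delta0 G f) = 0 := by
  have key : ∀ {x y : V} (c : G.Walk x y),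
      walkSum (gradForm G f) c = f x - f y := by
    intro x y c
    induction c with
    | nil => simp [walkSum]
    | cons h c ih =>
      simp only [walkSum, SimpleGraph.Walk.darts_cons, List.map_cons, List.sum_cons] at ih ⊢
      rw [ih]
      simp [gradForm_apply, h]
  funext c
  change walkSum (gradForm G f) c.1.2 = 0
  rw [key, sub_self]

/-- The first Betti number `β₁ = dim (ker δ₁ / Im δ₀)` of the 2-complex `M₂(G)`. -/
def betti1 {V : Type*} (G : SimpleGraph V) (d : V → V → ℝ) : ℕ :=
  Module.finrank ℝ
    (↥(LinearMap.ker (delta1 G d)) ⧸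
      (LinearMap.range (delta0 G)).submoduleOf (LinearMap.ker (delta1 G d)))

namespace MarkovChain

variable {V : Type*} [Fintype V] (M : MarkovChain V)

/-- The graph of the chain: distinct `x`, `y` are adjacent when `p x y > 0`. -/
def graph : SimpleGraph V where
  Adj x y := x ≠ y ∧ 0 < M.p x y
  symm := ⟨fun x y h => ⟨h.1.symm, (M.symm_support x y).1 h.2⟩⟩
  loopless := ⟨fun _ h => h.1 rfl⟩

/-- The minimal vertex degree of the graph of the chain. -/
def degMin : ℕ := by
  classical exact M.graph.minDegree

/-- The Laplacian `Δ f x = ∑ y, p x y (f y - f x)`. -/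
def laplacian (f : V → ℝ) (x : V) : ℝ := ∑ y, M.p x y * (f y - f x)

/-- The Ollivier curvature `κ(x, y)`, for `x ≠ y`: the infimum of `(Δ f x - Δ f y) / d x y` over
the functions `f` with `(f y - f x) / d y x = 1` and `‖∇f‖_∞ = 1`. -/
def curvature (d : V → V → ℝ) (x y : V) : ℝ :=
  sInf {r | ∃ f : V → ℝ, (f y - f x) / d y x = 1 ∧ lipConst d f = 1 ∧
    r = (M.laplacian f x - M.laplacian f y) / d x y}

/-- The operator `δ^(*) α x = ∑ y, p x y α(x, y)` from one-forms to functions. -/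
def deltaStar (α : OneForm M.graph) (x : V) : ℝ :=
  ∑ y, M.p x y * α x y

/-- `H₁(M₂(G))`: the one-forms `α` with `δ α = 0` and `δ^(*) α` constant. -/
def harmonicForms (d : V → V → ℝ) : Submodule ℝ (OneForm M.graph) where
  carrier := {α | delta1 M.graph d α = 0 ∧ ∃ c : ℝ, ∀ x, M.deltaStar α x = c}
  zero_mem' := ⟨map_zero _, 0, fun x => by simp [deltaStar]⟩
  add_mem' := by
    rintro α β ⟨ha, a, ha'⟩ ⟨hb, b, hb'⟩
    refine ⟨by rw [map_add, ha, hb, add_zero], a + b, fun x => ?_⟩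
    rw [← ha' x, ← hb' x]
    simp [deltaStar, mul_add, Finset.sum_add_distrib]
  smul_mem' := by
    rintro r α ⟨ha, a, ha'⟩
    refine ⟨by rw [map_smul, ha, smul_zero], r * a, fun x => ?_⟩
    rw [← ha' x]
    simp only [deltaStar, Finset.mul_sum]
    refine Finset.sum_congr rfl fun y _ => ?_
    rw [OneForm.smul_apply]
    ring

end MarkovChain

end OllivierBetti

end

/-! The equality is a Hodge decomposition. By the maximum principle a function with constant
Laplacian is constant, so by a dimension count every function is a Laplacian plus a constant. Hence
each class of closed forms has exactly one harmonic representative.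

For the bound, scale a non-zero harmonic form `α` so that the maximum of `α / d` is 1, and call an
edge saturated where `α = d`. The 2-cells allow three consecutive edges to be replaced by a geodesic
with the same integral of `α` (`exists_geodesic_of_adj`). So around a saturated edge the local
primitives of `α` satisfy the Lipschitz bound, and non-negative curvature compares Laplacians at its
two ends. As `deltaStar α` is constant, this comparison is an equality for the primitives
themselves, hence passes to first-order perturbations that increase along saturated geodesics
(`laplacian_le_of_saturated`).

Perturbing by the length of the longest saturated chain shows that infinite backward chains of
saturated edges exist (`exists_not_acc_saturated`) and that their endpoints form a set closed under
adjacency (`not_acc_saturated_of_adj`). So every vertex is the head of a saturated edge. At a vertex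
`v` of minimal degree, the functionals `α ↦ α w v / d w v` therefore always attain the norm with a
positive sign. Such a family contains a separating subfamily closed under negation, hence has at
least `2 dim` members (`two_mul_finrank_le_card`). -/

noncomputable section

namespace OllivierBetti

/-! ### Sums along walks. -/

section Walks

variable {V : Type*} {G : SimpleGraph V}

@[simp] theorem walkSum_nil (g : V → V → ℝ) (x : V) :
    walkSum g (SimpleGraph.Walk.nil : G.Walk x x) = 0 := by
  simp [walkSum]

@[simp] theorem walkSum_cons (g : V → V → ℝ) {x y z : V} (h : G.Adj x y) (c : G.Walk y z) :
    walkSum g (SimpleGraph.Walk.cons h c) = g x y + walkSum g c := by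
  simp [walkSum]

theorem walkSum_append (g : V → V → ℝ) {x y z : V} (c : G.Walk x y) (c' : G.Walk y z) :
    walkSum g (c.append c') = walkSum g c + walkSum g c' := by
  simp [walkSum]

theorem walkSum_copy (g : V → V → ℝ) {x y x' y' : V} (c : G.Walk x y) (hx : x = x')
    (hy : y = y') : walkSum g (c.copy hx hy) = walkSum g c := by
  subst hx hy
  rfl

theorem walkSum_reverse_of_antisymm {g : V → V → ℝ} (hg : ∀ x y, g x y = -g y x) {x y : V}
    (c : G.Walk x y) : walkSum g c.reverse = -walkSum g c := by
  induction c with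
  | nil => simp
  | cons h c ih =>
    rw [SimpleGraph.Walk.reverse_cons, walkSum_append, ih, walkSum_cons, walkSum_cons, walkSum_nil,
      hg]
    ring

theorem walkSum_reverse_of_symm {g : V → V → ℝ} (hg : ∀ x y, g x y = g y x) {x y : V}
    (c : G.Walk x y) : walkSum g c.reverse = walkSum g c := by
  induction c with
  | nil => simp
  | cons h c ih =>
    rw [SimpleGraph.Walk.reverse_cons, walkSum_append, ih, walkSum_cons, walkSum_cons, walkSum_nil,
      hg]
    ring

theorem walkSum_le_walkSum {g g' : V → V → ℝ} (h : ∀ x y, G.Adj x y → g x y ≤ g' x y) {x y : V}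
    (c : G.Walk x y) : walkSum g c ≤ walkSum g' c := by
  induction c with
  | nil => simp
  | cons hxy c ih =>
    rw [walkSum_cons, walkSum_cons]
    exact add_le_add (h _ _ hxy) ih

end Walks

namespace OneForm

variable {V : Type*} {G : SimpleGraph V} (α : OneForm G)

theorem antisymm (x y : V) : α x y = -α y x := α.2.1 x y

theorem apply_eq_zero {x y : V} (h : ¬ G.Adj x y) : α x y = 0 := α.2.2 x y h

@[simp] theorem apply_self (x : V) : α x x = 0 := α.apply_eq_zero (G.loopless.irrefl x)

end OneForm

/-! ### Geodesics of a path distance. -/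

namespace IsPathDistance

variable {V : Type*} {G : SimpleGraph V} {d : V → V → ℝ}

theorem self_eq_zero (hd : IsPathDistance G d) (x : V) : d x x = 0 := (hd.eq_zero_iff x x).2 rfl

theorem pos (hd : IsPathDistance G d) {x y : V} (h : x ≠ y) : 0 < d x y :=
  lt_of_le_of_ne (hd.nonneg x y) fun h0 => h ((hd.eq_zero_iff x y).1 h0.symm)

theorem le_walkSum (hd : IsPathDistance G d) {x y : V} (c : G.Walk x y) : d x y ≤ walkSum d c :=
  (hd.isGLB x y).1 ⟨c, rfl⟩

/-- The first step of a geodesic. -/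
theorem exists_adj_add_le [Finite V] (hd : IsPathDistance G d) {x y : V} (h : x ≠ y) :
    ∃ z, G.Adj x z ∧ d x z + d z y ≤ d x y := by
  by_contra! hcon
  have := Fintype.ofFinite V
  -- There are finitely many first steps, so they all exceed `d x y` by a uniform gap, which
  -- contradicts the infimum.
  have hex : ∃ m, d x y < m ∧ ∀ z, G.Adj x z → m ≤ d x z + d z y := by
    classical
    by_cases hne : (Finset.univ.filter fun z => G.Adj x z).Nonempty
    · obtain ⟨w, hw, hmin⟩ := Finset.exists_min_image _ (fun z => d x z + d z y) hne
      exact ⟨_, hcon w (by simpa using hw), fun z hz => hmin z (by simpa using hz)⟩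
    · refine ⟨d x y + 1, by linarith, fun z hz => absurd ⟨z, by simpa using hz⟩ hne⟩
  obtain ⟨m, hm, hmle⟩ := hex
  have : m ∈ lowerBounds (Set.range fun c : G.Walk x y => walkSum d c) := by
    rintro _ ⟨c, rfl⟩
    cases c with
    | nil => exact absurd rfl h
    | cons hxz c =>
      have h1 := hmle _ hxz
      have h2 := hd.le_walkSum c
      simp only [walkSum_cons]
      linarith
  exact absurd ((hd.isGLB x y).2 this) (not_le.2 hm)

/-- Any two vertices are joined by a path that is a geodesic. -/
theorem exists_geodesic [Finite V] (hd : IsPathDistance G d) (x y : V) :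
    ∃ c : G.Walk x y, c.IsPath ∧ walkSum d c = d x y := by
  -- The last clause keeps the walk a path: the vertices after `x` are strictly nearer to `y`, so
  -- `x` does not recur.
  suffices H : ∃ c : G.Walk x y, c.IsPath ∧ walkSum d c ≤ d x y ∧
      ∀ v ∈ c.support, d v y ≤ d x y by
    obtain ⟨c, hc, hle, -⟩ := H
    exact ⟨c, hc, le_antisymm hle (hd.le_walkSum c)⟩
  have : IsTrans V fun a b => d a y < d b y := ⟨fun _ _ _ => lt_trans⟩
  have : Std.Irrefl fun a b => d a y < d b y := ⟨fun _ => lt_irrefl _⟩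
  have wf : WellFounded fun a b => d a y < d b y := Finite.wellFounded_of_trans_of_irrefl _
  induction x using wf.induction with
  | _ x ih =>
    by_cases h : x = y
    · subst h
      exact ⟨.nil, by simp, by simp [hd.self_eq_zero], by simp⟩
    · obtain ⟨z, hz, hle⟩ := hd.exists_adj_add_le h
      have hlt : d z y < d x y := by linarith [hd.pos hz.ne]
      obtain ⟨c, hc, hcle, hsup⟩ := ih z hlt
      refine ⟨.cons hz c, ?_, ?_, ?_⟩
      · rw [SimpleGraph.Walk.cons_isPath_iff]
        exact ⟨hc, fun hx => absurd (hsup x hx) (not_le.2 hlt)⟩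
      · rw [walkSum_cons]
        linarith
      · intro v hv
        rw [SimpleGraph.Walk.support_cons, List.mem_cons] at hv
        rcases hv with rfl | hv
        · exact le_rfl
        · exact (hsup v hv).trans hlt.le

theorem triangle [Finite V] (hd : IsPathDistance G d) (x y z : V) : d x z ≤ d x y + d y z := by
  obtain ⟨c, -, hc⟩ := hd.exists_geodesic x y
  obtain ⟨c', -, hc'⟩ := hd.exists_geodesic y z
  rw [← hc, ← hc', ← walkSum_append]
  exact hd.le_walkSum _

theorem eq_add_of_mem_support [Finite V] (hd : IsPathDistance G d) {x y v : V} {c : G.Walk x y}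
    (hc : walkSum d c = d x y) (hv : v ∈ c.support) : d x y = d x v + d v y := by
  classical
  refine le_antisymm (hd.triangle x v y) ?_
  rw [← hc, ← c.take_spec hv, walkSum_append]
  exact add_le_add (hd.le_walkSum _) (hd.le_walkSum _)

end IsPathDistance

/-! ### Replacing short walks by geodesics through 2-cells. -/

section Fill

variable {V : Type*} {G : SimpleGraph V} {d : V → V → ℝ} {α : OneForm G}

theorem walkSum_eq_zero_of_isTwoCell (hα : delta1 G d α = 0) {x : V} {c : G.Walk x x}
    (hc : IsTwoCell d c) : walkSum α c = 0 :=
  congrFun hα ⟨⟨x, c⟩, hc⟩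

/-- A closed one-form vanishes on a cycle made of three edges that do not form a geodesic, and a
geodesic. -/
theorem walkSum_eq_of_geodesic (hd : IsPathDistance G d) (hα : delta1 G d α = 0)
    {x' x y y' : V} (h₁ : G.Adj x' x) (h₂ : G.Adj x y) (h₃ : G.Adj y y') {c : G.Walk x' y'}
    (hc : c.IsPath) (hgeo : walkSum d c = d x' y') (hx : x ∉ c.support)
    (hy : y ∉ c.support) (hlt : d x' y' < d x' x + d x y + d y y') :
    walkSum α c = α x' x + α x y + α y y' := by
  have hcell : IsTwoCell d (.cons h₁ (.cons h₂ (.cons h₃ c.reverse))) := by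
    refine ⟨?_, Or.inr ?_⟩
    · rw [SimpleGraph.Walk.cons_isCycle_iff]
      refine ⟨?_, ?_⟩
      · simp [SimpleGraph.Walk.cons_isPath_iff, hx, hy, hc, h₂.ne]
      · simp only [SimpleGraph.Walk.edges_cons, List.mem_cons, not_or]
        refine ⟨?_, ?_, fun h => hx ?_⟩
        · intro h
          rw [Sym2.eq_swap, Sym2.congr_right] at h
          exact hy (h ▸ c.start_mem_support)
        · intro h
          have : x ∈ s(y, y') := h ▸ Sym2.mem_mk_right x' x
          rw [Sym2.mem_iff] at this
          exact this.elim h₂.ne fun h => hx (h ▸ c.end_mem_support)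
        · have := SimpleGraph.Walk.snd_mem_support_of_mem_edges _ h
          simpa using this
    -- This alternative also covers the triangle `x' = y'`, where the geodesic is trivial.
    · refine ⟨by simpa [SimpleGraph.Walk.getVert_cons_succ] using hlt, ?_⟩
      simp [SimpleGraph.Walk.drop, walkSum_copy, walkSum_reverse_of_symm hd.symm, hgeo, hd.symm]
  have := walkSum_eq_zero_of_isTwoCell hα hcell
  simp only [walkSum_cons, walkSum_reverse_of_antisymm α.antisymm] at this
  linarith

/-- Two consecutive edges can be replaced by a geodesic without changing the integral of a closed
one-form. -/
theorem exists_geodesic_of_adj_adj [Finite V] (hd : IsPathDistance G d) (hα : delta1 G d α = 0)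
    {x y z : V} (hxy : G.Adj x y) (hyz : G.Adj y z) :
    ∃ c : G.Walk x z, walkSum d c = d x z ∧ walkSum α c = α x y + α y z := by
  rcases (hd.triangle x y z).eq_or_lt with heq | hlt
  · exact ⟨.cons hxy (.cons hyz .nil), by simp [heq], by simp⟩
  obtain ⟨c, hc, hgeo⟩ := hd.exists_geodesic x z
  have hy : y ∉ c.support := fun hy => hlt.ne (hd.eq_add_of_mem_support hgeo hy)
  cases c with
  | nil =>
    refine ⟨.nil, hgeo, ?_⟩
    rw [walkSum_nil, α.antisymm x y]
    ring
  | @cons _ p _ hxp c =>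
    refine ⟨.cons hxp c, hgeo, ?_⟩
    rw [SimpleGraph.Walk.cons_isPath_iff] at hc
    rw [SimpleGraph.Walk.support_cons, List.mem_cons, not_or] at hy
    rw [walkSum_cons] at hgeo ⊢
    have h1 := hd.le_walkSum c
    have h2 := hd.triangle x p z
    have h3 := hd.pos hxp.ne
    -- The first edge of the geodesic, traversed backwards, supplies the missing third edge of the
    -- cell. Strictness is automatic, since `p` is nearer to `z` than `x` is.
    rw [walkSum_eq_of_geodesic hd hα hxp.symm hxy hyz hc.1 (by linarith) hc.2 hy.2
      (by rw [hd.symm p x]; linarith), α.antisymm x p]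
    ring

/-- Three consecutive edges, of which the first and the last may be degenerate, can be replaced by
a geodesic without changing the integral of a closed one-form. -/
theorem exists_geodesic_of_adj [Finite V] (hd : IsPathDistance G d) (hα : delta1 G d α = 0)
    {x' x y y' : V} (h₁ : x' = x ∨ G.Adj x' x) (h₂ : G.Adj x y) (h₃ : y = y' ∨ G.Adj y y') :
    ∃ c : G.Walk x' y', walkSum d c = d x' y' ∧
      walkSum α c = α x' x + α x y + α y y' := by
  rcases h₁ with rfl | h₁
  · rcases h₃ with rfl | h₃
    · exact ⟨.cons h₂ .nil, by simp, by simp⟩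
    · simpa using exists_geodesic_of_adj_adj hd hα h₂ h₃
  rcases h₃ with rfl | h₃
  · simpa using exists_geodesic_of_adj_adj hd hα h₁ h₂
  obtain ⟨c, hc, hgeo⟩ := hd.exists_geodesic x' y'
  -- If a geodesic meets `x` or `y`, the distance splits there and only two edges remain to be
  -- replaced; otherwise the cycle is embedded.
  by_cases hx : x ∈ c.support
  · obtain ⟨w, hw, hw'⟩ := exists_geodesic_of_adj_adj hd hα h₂ h₃
    refine ⟨.cons h₁ w, ?_, ?_⟩
    · rw [walkSum_cons, hw, hd.eq_add_of_mem_support hgeo hx]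
    · rw [walkSum_cons, hw']
      ring
  by_cases hy : y ∈ c.support
  · obtain ⟨w, hw, hw'⟩ := exists_geodesic_of_adj_adj hd hα h₁ h₂
    refine ⟨w.append (.cons h₃ .nil), ?_, ?_⟩
    · rw [walkSum_append, hw, hd.eq_add_of_mem_support hgeo hy]
      simp
    · rw [walkSum_append, hw']
      simp
  rcases (hd.triangle x' x y').eq_or_lt with heq | hlt
  · obtain ⟨w, hw, hw'⟩ := exists_geodesic_of_adj_adj hd hα h₂ h₃
    refine ⟨.cons h₁ w, ?_, ?_⟩
    · rw [walkSum_cons, hw, heq]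
    · rw [walkSum_cons, hw']
      ring
  · exact ⟨c, hgeo, walkSum_eq_of_geodesic hd hα h₁ h₂ h₃ hc hgeo hx hy
      (by linarith [hd.triangle x y y'])⟩

end Fill

/-! ### Laplacian, maximum principle and curvature comparison. -/

namespace MarkovChain

variable {V : Type*} [Fintype V] (M : MarkovChain V)

theorem eq_zero_of_not_adj {x y : V} (hne : x ≠ y) (h : ¬ M.graph.Adj x y) : M.p x y = 0 :=
  le_antisymm (not_lt.1 fun hp => h ⟨hne, hp⟩) (M.nonneg x y)

theorem eq_or_adj {x y : V} (h : 0 < M.p x y) : x = y ∨ M.graph.Adj x y :=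
  or_iff_not_imp_left.2 fun hne => ⟨hne, h⟩

/-- A set of states that is closed under transitions and contains a state contains every state. -/
theorem forall_of_adj_closed {P : V → Prop} {x : V} (hx : P x)
    (h : ∀ x y, M.graph.Adj x y → P x → P y) (y : V) : P y := by
  induction M.irreducible x y with
  | refl => exact hx
  | tail _ hbc ih =>
    rcases M.eq_or_adj hbc with rfl | hadj
    · exact ih
    · exact h _ _ hadj ih

theorem laplacian_le_of_le {f g : V → ℝ} {x : V} (hx : f x = g x)
    (h : ∀ y, x = y ∨ M.graph.Adj x y → f y ≤ g y) : M.laplacian f x ≤ M.laplacian g x := by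
  refine Finset.sum_le_sum fun y _ => ?_
  rcases (M.nonneg x y).eq_or_lt with h0 | hpos
  · simp [← h0]
  · exact mul_le_mul_of_nonneg_left (by linarith [h y (M.eq_or_adj hpos)]) hpos.le

theorem laplacian_add (f g : V → ℝ) (x : V) :
    M.laplacian (f + g) x = M.laplacian f x + M.laplacian g x := by
  simp only [laplacian, ← Finset.sum_add_distrib, Pi.add_apply]
  exact Finset.sum_congr rfl fun y _ => by ring

theorem laplacian_smul (r : ℝ) (f : V → ℝ) (x : V) :
    M.laplacian (r • f) x = r * M.laplacian f x := by
  simp only [laplacian, Finset.mul_sum, Pi.smul_apply, smul_eq_mul]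
  exact Finset.sum_congr rfl fun y _ => by ring

theorem laplacian_add_const (f : V → ℝ) (c : ℝ) (x : V) :
    M.laplacian (fun z => f z + c) x = M.laplacian f x := by
  simp [laplacian]

/-- The Laplacian at `x` of the local primitive of `α` at `x`. -/
theorem laplacian_apply_self (α : OneForm M.graph) (x : V) :
    M.laplacian (fun z => α z x) x = -M.deltaStar α x := by
  simp only [laplacian, deltaStar, α.apply_self, sub_zero, ← Finset.sum_neg_distrib]
  exact Finset.sum_congr rfl fun y _ => by rw [α.antisymm x y]; ring

/-- Maximum principle. -/
theorem eq_of_laplacian_nonneg {f : V → ℝ} {x y : V} (hmax : ∀ z, f z ≤ f x)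
    (h : 0 ≤ M.laplacian f x) (hxy : M.graph.Adj x y) : f y = f x := by
  have hle : ∀ z ∈ Finset.univ, M.p x z * (f z - f x) ≤ 0 := fun z _ =>
    mul_nonpos_of_nonneg_of_nonpos (M.nonneg x z) (by linarith [hmax z])
  have h0 : M.laplacian f x = 0 := le_antisymm (Finset.sum_nonpos hle) h
  have := (Finset.sum_eq_zero_iff_of_nonpos hle).1 h0 y (Finset.mem_univ y)
  rcases mul_eq_zero.1 this with h1 | h1
  · exact absurd h1 hxy.2.ne'
  · linarith

theorem laplacian_nonneg_of_min {f : V → ℝ} {x : V} (hmin : ∀ z, f x ≤ f z) :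
    0 ≤ M.laplacian f x :=
  Finset.sum_nonneg fun z _ => mul_nonneg (M.nonneg x z) (by linarith [hmin z])

/-- Non-negative curvature, in terms of a `1`-Lipschitz function that is as steep as possible from
`x` to `y`. -/
theorem laplacian_le_of_curvature_nonneg {d : V → V → ℝ} (hd : IsPathDistance M.graph d) {x y : V}
    (hne : x ≠ y) (hκ : 0 ≤ M.curvature d x y) {g : V → ℝ} (hg : ∀ a b, g a - g b ≤ d a b)
    (hxy : g x - g y = d x y) : M.laplacian g x ≤ M.laplacian g y := by
  have hdpos := hd.pos hne
  have hlip : lipConst d (-g) = 1 := by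
    refine IsGreatest.csSup_eq ⟨⟨x, y, hne, ?_⟩, ?_⟩
    · have : (-g) x - (-g) y = -d x y := by
        simp only [Pi.neg_apply]
        linarith
      rw [this, neg_div, div_self hdpos.ne']
      simp
    · rintro _ ⟨a, b, hab, rfl⟩
      rw [abs_div, abs_of_pos (hd.pos hab), div_le_one (hd.pos hab), abs_le]
      have h1 := hg a b
      have h2 := hg b a
      rw [hd.symm b a] at h2
      simp only [Pi.neg_apply]
      constructor <;> linarith
  -- The real `sInf` of a set unbounded below is 0, so a lower bound is needed before the curvature
  -- says anything about a single function. The competitor below is `-g`, because the curvature is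
  -- taken over functions increasing from `x` to `y`.
  have hbdd : BddBelow {r | ∃ f : V → ℝ, (f y - f x) / d y x = 1 ∧ lipConst d f = 1 ∧
      r = (M.laplacian f x - M.laplacian f y) / d x y} := by
    refine ⟨(∑ z, M.p x z * (-d z x) - ∑ z, M.p y z * d z y) / d x y, ?_⟩
    rintro _ ⟨f, -, hf, rfl⟩
    have hfl : ∀ a b, |f a - f b| ≤ d a b := by
      intro a b
      by_cases hab : a = b
      · subst hab
        simp [hd.self_eq_zero]
      have hfin : BddAbove {r | ∃ x y, x ≠ y ∧ r = |(f x - f y) / d x y|} := by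
        refine ((Set.finite_range fun q : V × V => |(f q.1 - f q.2) / d q.1 q.2|).subset
          ?_).bddAbove
        rintro _ ⟨a, b, -, rfl⟩
        exact ⟨(a, b), rfl⟩
      have := le_csSup hfin ⟨a, b, hab, rfl⟩
      rw [← lipConst, hf, abs_div, abs_of_pos (hd.pos hab), div_le_one (hd.pos hab)] at this
      exact this
    refine div_le_div_of_nonneg_right (sub_le_sub ?_ ?_) hdpos.le
    · exact Finset.sum_le_sum fun z _ =>
        mul_le_mul_of_nonneg_left (abs_le.1 (hfl z x)).1 (M.nonneg x z)
    · exact Finset.sum_le_sum fun z _ =>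
        mul_le_mul_of_nonneg_left (abs_le.1 (hfl z y)).2 (M.nonneg y z)
  have := hκ.trans (csInf_le hbdd ⟨-g, by
    rw [hd.symm y x, ← hxy]
    simp only [Pi.neg_apply]
    rw [div_eq_one_iff_eq (by rw [hxy]; exact hdpos.ne')]
    ring, hlip, rfl⟩)
  have h2 := mul_nonneg this hdpos.le
  rw [div_mul_cancel₀ _ hdpos.ne'] at h2
  have hneg : ∀ z, M.laplacian (-g) z = -M.laplacian g z := fun z => by
    simpa using M.laplacian_smul (-1) g z
  rw [hneg, hneg] at h2
  linarith

/-- Non-negative curvature gives the comparison of the Laplacians at `x` and `y` of two functions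
`f₁`, `f₂` such that `f₁ x' - f₂ y' ≤ d x' y'` near `x` and `y`, with equality at `x` and `y`. -/
theorem laplacian_le_of_sub_le {d : V → V → ℝ} (hd : IsPathDistance M.graph d) {x y : V}
    (hne : x ≠ y) (hκ : 0 ≤ M.curvature d x y) {f₁ f₂ : V → ℝ}
    (hf : ∀ x' y', (x = x' ∨ M.graph.Adj x x') → (y = y' ∨ M.graph.Adj y y') →
      f₁ x' - f₂ y' ≤ d x' y') (hxy : f₁ x - f₂ y = d x y) :
    M.laplacian f₁ x ≤ M.laplacian f₂ y := by
  classical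
  let B : Finset V := Finset.univ.filter fun x' => x = x' ∨ M.graph.Adj x x'
  have hB : ∀ {x'}, x' ∈ B ↔ x = x' ∨ M.graph.Adj x x' := by simp [B]
  have hBne : B.Nonempty := ⟨x, hB.2 (Or.inl rfl)⟩
  -- McShane extension of `f₁` from the unit ball at `x`: it lies above `f₁` there, and below `f₂`
  -- on the ball at `y`.
  let g : V → ℝ := fun z => B.sup' hBne fun x' => f₁ x' - d x' z
  have hglip : ∀ a b, g a - g b ≤ d a b := by
    intro a b
    rw [sub_le_iff_le_add]
    refine Finset.sup'_le _ _ fun x' hx' => ?_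
    have h1 : f₁ x' - d x' b ≤ g b := Finset.le_sup' (fun x' => f₁ x' - d x' b) hx'
    have h2 := hd.triangle x' a b
    linarith
  have hg₁ : ∀ x' ∈ B, f₁ x' ≤ g x' := fun x' hx' => by
    have := Finset.le_sup' (fun z => f₁ z - d z x') hx'
    simpa [hd.self_eq_zero] using this
  have hg₂ : ∀ y', (y = y' ∨ M.graph.Adj y y') → g y' ≤ f₂ y' := fun y' hy' =>
    Finset.sup'_le _ _ fun x' hx' => by linarith [hf x' y' (hB.1 hx') hy']
  have h1 := hg₁ x (hB.2 (Or.inl rfl))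
  have h2 := hg₂ y (Or.inl rfl)
  have h3 := hglip x y
  exact (M.laplacian_le_of_le (by linarith) fun z hz => hg₁ z (hB.2 hz)).trans
    ((M.laplacian_le_of_curvature_nonneg hd hne hκ hglip (by linarith)).trans
      (M.laplacian_le_of_le (by linarith) hg₂))

/-- The infinitesimal version of `laplacian_le_of_sub_le` at the local primitive of a harmonic
one-form `α` of norm at most one that is saturated at the edge `(x, y)`. -/
theorem laplacian_le_of_saturated {d : V → V → ℝ} (hd : IsPathDistance M.graph d)
    {α : OneForm M.graph} (hα : α ∈ M.harmonicForms d) (hle : ∀ a b, M.graph.Adj a b → α a b ≤ d a b)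
    {x y : V} (hadj : M.graph.Adj x y) (hκ : 0 ≤ M.curvature d x y) (hxy : α x y = d x y)
    {u₁ u₂ : V → ℝ} (hu : u₁ x = u₂ y)
    (hu' : ∀ x' y' (c : M.graph.Walk x' y'), (x = x' ∨ M.graph.Adj x x') →
      (y = y' ∨ M.graph.Adj y y') → walkSum α c = walkSum d c →
      walkSum d c = α x' x + α x y + α y y' → u₁ x' ≤ u₂ y') :
    M.laplacian u₁ x ≤ M.laplacian u₂ y := by
  obtain ⟨hδ, k, hk⟩ := hα
  have hwalk : ∀ x' y', (x = x' ∨ M.graph.Adj x x') → (y = y' ∨ M.graph.Adj y y') →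
      α x' x + α x y + α y y' ≤ d x' y' ∧
        (α x' x + α x y + α y y' = d x' y' → u₁ x' ≤ u₂ y') := by
    intro x' y' hx' hy'
    obtain ⟨c, hc, hc'⟩ := exists_geodesic_of_adj hd hδ
      (hx'.imp Eq.symm fun h => h.symm) hadj hy'
    refine ⟨?_, fun h => hu' x' y' c hx' hy' ?_ ?_⟩
    · rw [← hc', ← hc]
      exact walkSum_le_walkSum hle c
    · rw [hc, hc', h]
    · rw [hc, h]
  -- Pairs with strict inequality have slack for small `ε`; pairs with equality are handled by `u₁
  -- x' ≤ u₂ y'`. There are finitely many pairs.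
  obtain ⟨ε, hε, hεle⟩ : ∃ ε : ℝ, 0 < ε ∧ ∀ x' y', (x = x' ∨ M.graph.Adj x x') →
      (y = y' ∨ M.graph.Adj y y') →
      α x' x + α x y + α y y' + ε * (u₁ x' - u₂ y') ≤ d x' y' := by
    have hev : ∀ᶠ ε : ℝ in nhdsWithin 0 (Set.Ioi 0), ∀ q : V × V, (x = q.1 ∨ M.graph.Adj x q.1) →
        (y = q.2 ∨ M.graph.Adj y q.2) →
        α q.1 x + α x y + α y q.2 + ε * (u₁ q.1 - u₂ q.2) ≤ d q.1 q.2 := by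
      rw [Filter.eventually_all]
      rintro ⟨x', y'⟩
      by_cases hcase : (x = x' ∨ M.graph.Adj x x') ∧ (y = y' ∨ M.graph.Adj y y')
      swap
      · exact Filter.Eventually.of_forall fun ε h1 h2 => absurd ⟨h1, h2⟩ hcase
      obtain ⟨h1, h2⟩ := hwalk x' y' hcase.1 hcase.2
      rcases h1.eq_or_lt with heq | hlt
      · filter_upwards [self_mem_nhdsWithin] with ε hε _ _
        have := mul_nonpos_of_nonneg_of_nonpos (Set.mem_Ioi.1 hε).le (sub_nonpos.2 (h2 heq))
        linarith
      · have hcont : Continuous fun ε : ℝ =>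
            α x' x + α x y + α y y' + ε * (u₁ x' - u₂ y') := by fun_prop
        have ht : Filter.Tendsto (fun ε : ℝ => α x' x + α x y + α y y' + ε * (u₁ x' - u₂ y'))
            (nhdsWithin 0 (Set.Ioi 0)) (nhds (α x' x + α x y + α y y')) := by
          simpa using (hcont.continuousWithinAt (s := Set.Ioi 0) (x := 0)).tendsto
        exact (ht.eventually_lt_const hlt).mono fun ε h _ _ => h.le
    obtain ⟨ε, hε, hpos⟩ := (hev.and self_mem_nhdsWithin).exists
    exact ⟨ε, hpos, fun x' y' => hε (x', y')⟩
  have := M.laplacian_le_of_sub_le hd hadj.ne hκ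
    (f₁ := (fun z => α z x) + ε • u₁) (f₂ := (fun z => α z y + -d x y) + ε • u₂)
    (fun x' y' hx' hy' => by
      have := hεle x' y' hx' hy'
      rw [α.antisymm y y'] at this
      simp only [Pi.add_apply, Pi.smul_apply, smul_eq_mul]
      linarith)
    (by simp [hu])
  -- The zeroth-order terms are both `-k` and cancel, leaving `ε` times the claim.
  rw [laplacian_add, laplacian_add, laplacian_smul, laplacian_smul, laplacian_add_const,
    laplacian_apply_self, laplacian_apply_self, hk, hk] at this
  exact le_of_mul_le_mul_left (by linarith) hε

end MarkovChain

/-! ### Chains of saturated edges. -/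

/-- The largest weight of an `S`-chain ending at an accessible point. -/
theorem exists_longest_chain {V : Type*} [Finite V] (S : V → V → Prop) (w : V → V → ℝ) :
    ∃ ℓ : V → ℝ, ∀ v, 0 ≤ ℓ v ∧ (∀ a, S a v → Acc S v → ℓ a + w a v ≤ ℓ v) ∧
      (ℓ v = 0 ∨ ∃ a, S a v ∧ Acc S v ∧ ℓ v = ℓ a + w a v) := by
  classical
  have := Fintype.ofFinite V
  -- Dropping the steps into inaccessible points makes the relation well-founded, so `ℓ` can be
  -- defined by recursion; it vanishes at inaccessible points.
  let S' : V → V → Prop := fun a b => S a b ∧ Acc S b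
  have hS' : WellFounded S' := by
    refine ⟨fun b => ?_⟩
    by_cases hb : Acc S b
    · exact Subrelation.accessible (fun h => h.1) hb
    · exact ⟨b, fun a ha => absurd ha.2 hb⟩
  let F : (v : V) → ((a : V) → S' a v → ℝ) → ℝ := fun v rec =>
    Finset.univ.sup' ⟨v, Finset.mem_univ v⟩ fun a => if h : S' a v then rec a h + w a v else 0
  let ℓ : V → ℝ := hS'.fix F
  have hℓ : ∀ v, ℓ v = Finset.univ.sup' ⟨v, Finset.mem_univ v⟩
      fun a => if S' a v then ℓ a + w a v else 0 := by
    intro v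
    change hS'.fix F v = _
    rw [hS'.fix_eq]
    simp only [F, ℓ, dite_eq_ite]
  have hle : ∀ v a, (if S' a v then ℓ a + w a v else 0) ≤ ℓ v := by
    intro v a
    rw [hℓ v]
    exact Finset.le_sup' (fun a => if S' a v then ℓ a + w a v else 0) (Finset.mem_univ a)
  refine ⟨ℓ, fun v => ⟨?_, fun a ha hv => ?_, ?_⟩⟩
  -- The term `a = v` of the maximum is 0, by irreflexivity.
  · have := hle v v
    rwa [if_neg (hS'.irrefl.irrefl v)] at this
  · have := hle v a
    rwa [if_pos ⟨ha, hv⟩] at this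
  · obtain ⟨a, -, ha⟩ := Finset.exists_mem_eq_sup' (s := Finset.univ) ⟨v, Finset.mem_univ v⟩
      fun a => if S' a v then ℓ a + w a v else 0
    rw [← hℓ v] at ha
    by_cases h : S' a v
    · rw [if_pos h] at ha
      exact Or.inr ⟨a, h.1, h.2, ha⟩
    · rw [if_neg h] at ha
      exact Or.inl ha

/-- The oriented edges at which the one-form `α` attains the value `d`. -/
def Saturated {V : Type*} {G : SimpleGraph V} (d : V → V → ℝ) (α : OneForm G) (a b : V) : Prop :=
  G.Adj a b ∧ α a b = d a b

/-- Equality of the two sums forces every edge of the walk to be saturated. This supplies the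
monotonicity that `laplacian_le_of_saturated` asks of its perturbations. -/
theorem acc_saturated_of_walk {V : Type*} {G : SimpleGraph V} {d : V → V → ℝ} {α : OneForm G}
    (hle : ∀ a b, G.Adj a b → α a b ≤ d a b) {ℓ : V → ℝ}
    (hℓ : ∀ a v, Saturated d α a v → Acc (Saturated d α) v → ℓ a + d a v ≤ ℓ v) {x y : V}
    (c : G.Walk x y) (hc : walkSum α c = walkSum d c) (hy : Acc (Saturated d α) y) :
    Acc (Saturated d α) x ∧ ℓ x + walkSum d c ≤ ℓ y := by
  induction c with
  | nil => simpa using hy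
  | @cons a b z h c ih =>
    rw [walkSum_cons, walkSum_cons] at hc
    have h1 := hle a b h
    have h2 := walkSum_le_walkSum hle c
    obtain ⟨h3, h4⟩ := ih (by linarith) hy
    have hab : Saturated d α a b := ⟨h, by linarith⟩
    refine ⟨h3.inv hab, ?_⟩
    have := hℓ a b hab h3
    rw [walkSum_cons]
    linarith

namespace MarkovChain

variable {V : Type*} [Fintype V] {M : MarkovChain V} {d : V → V → ℝ} {α : OneForm M.graph}

/-- Saturated edges cannot form a directed graph without cycles. -/
theorem exists_not_acc_saturated (hd : IsPathDistance M.graph d)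
    (hκ : ∀ x y, x ≠ y → 0 ≤ M.curvature d x y) (hα : α ∈ M.harmonicForms d)
    (hle : ∀ a b, M.graph.Adj a b → α a b ≤ d a b) {x y : V} (hxy : Saturated d α x y) :
    ∃ v, ¬ Acc (Saturated d α) v := by
  by_contra! hacc
  obtain ⟨ℓ, hℓ⟩ := exists_longest_chain (Saturated d α) d
  -- The gain of `ℓ` along a saturated geodesic is at least its length, which is an integral of `α`;
  -- adding the local primitives to `ℓ` absorbs it. Their Laplacians cancel again.
  have hstep : ∀ a b, Saturated d α a b → ℓ b = ℓ a + d a b →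
      M.laplacian ℓ a ≤ M.laplacian ℓ b := by
    intro a b hab heq
    have := M.laplacian_le_of_saturated hd hα hle hab.1 (hκ a b hab.1.ne) hab.2
      (u₁ := (fun z => α z a) + ℓ) (u₂ := fun z => ((fun z => α z b) + ℓ) z + -d a b)
      (by simp [heq])
      (fun x' y' c _ _ hc hc' => by
        have := (acc_saturated_of_walk hle (fun a v => (hℓ v).2.1 a) c hc (hacc y')).2
        rw [hc', hab.2, α.antisymm b y'] at this
        simp only [Pi.add_apply]
        linarith)
    rw [laplacian_add_const, laplacian_add, laplacian_add, laplacian_apply_self,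
      laplacian_apply_self] at this
    obtain ⟨k, hk⟩ := hα.2
    rw [hk, hk] at this
    linarith
  -- Tracing a longest chain back reaches a minimum of `ℓ`, where the Laplacian is non-negative. So
  -- `ℓ` is subharmonic everywhere, hence constant, which a saturated edge forbids.
  have hroot : ∀ v, ∃ r, ℓ r = 0 ∧ M.laplacian ℓ r ≤ M.laplacian ℓ v := by
    intro v
    induction hacc v with
    | intro v _ ih =>
      rcases (hℓ v).2.2 with h0 | ⟨a, ha, -, heq⟩
      · exact ⟨v, h0, le_rfl⟩
      · obtain ⟨r, hr, hr'⟩ := ih a ha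
        exact ⟨r, hr, hr'.trans (hstep a v ha heq)⟩
  obtain ⟨v, -, hv⟩ := Finset.exists_max_image Finset.univ ℓ ⟨x, Finset.mem_univ x⟩
  have hall : ∀ z, ℓ z = ℓ v := M.forall_of_adj_closed (P := fun z => ℓ z = ℓ v) rfl
    fun a b hab ha => by
      obtain ⟨r, hr, hr'⟩ := hroot a
      have h0 : 0 ≤ M.laplacian ℓ r := M.laplacian_nonneg_of_min fun z => hr ▸ (hℓ z).1
      rw [← ha]
      exact M.eq_of_laplacian_nonneg (fun z => ha ▸ hv z (Finset.mem_univ z)) (h0.trans hr') hab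
  have h1 := (hℓ y).2.1 x hxy (hacc y)
  rw [hall x, hall y] at h1
  linarith [hd.pos hxy.1.ne]

/-- The set of vertices that end an infinite chain of saturated edges is closed under taking
neighbours. -/
theorem not_acc_saturated_of_adj (hd : IsPathDistance M.graph d)
    (hκ : ∀ x y, x ≠ y → 0 ≤ M.curvature d x y) (hα : α ∈ M.harmonicForms d)
    (hle : ∀ a b, M.graph.Adj a b → α a b ≤ d a b) {x z : V} (hxz : M.graph.Adj x z)
    (hx : ¬ Acc (Saturated d α) x) : ¬ Acc (Saturated d α) z := by
  classical
  intro hz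
  obtain ⟨ℓ, hℓ⟩ := exists_longest_chain (Saturated d α) d
  obtain ⟨K, hK⟩ : ∃ K, ∀ q : V × V, α q.1 q.2 + ℓ q.1 ≤ K :=
    (Set.finite_range fun q : V × V => α q.1 q.2 + ℓ q.1).bddAbove.imp
      fun K hK q => hK ⟨q, rfl⟩
  obtain ⟨δ, hδ, hδd⟩ : ∃ δ, 0 < δ ∧ ∀ a b, M.graph.Adj a b → δ ≤ d a b := by
    obtain ⟨q, hq, hmin⟩ := Finset.exists_min_image
      (Finset.univ.filter fun q : V × V => M.graph.Adj q.1 q.2) (fun q => d q.1 q.2)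
      ⟨(x, z), by simpa using hxz⟩
    refine ⟨d q.1 q.2, hd.pos (M.graph.ne_of_adj (by simpa using hq)), fun a b hab =>
      hmin (a, b) (by simpa using hab)⟩
  -- The previous perturbation, lowered by `t` on the accessible set and cut off to 0 elsewhere. For
  -- `t ≥ K` it is non-positive, so it remains monotone along saturated geodesics that leave the
  -- accessible set.
  let u : V → ℝ → V → ℝ := fun a t b =>
    if Acc (Saturated d α) b then α b a + ℓ b - t else 0
  have hu0 : ∀ a t, ¬ Acc (Saturated d α) a → u a t a = 0 := fun a t ha => if_neg ha
  have hupos : ∀ a t b, Acc (Saturated d α) b → u a t b = α b a + ℓ b - t :=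
    fun a t b hb => if_pos hb
  have hunonpos : ∀ a t b, K ≤ t → u a t b ≤ 0 := by
    intro a t b ht
    by_cases hb : Acc (Saturated d α) b
    · rw [hupos a t b hb]
      linarith [hK (b, a)]
    · exact (if_neg hb).le
  have hanti : ∀ a s t, ¬ Acc (Saturated d α) a → s ≤ t →
      M.laplacian (u a t) a ≤ M.laplacian (u a s) a := by
    intro a s t ha hst
    refine M.laplacian_le_of_le (by rw [hu0 a s ha, hu0 a t ha]) fun b _ => ?_
    by_cases hb : Acc (Saturated d α) b
    · rw [hupos a t b hb, hupos a s b hb]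
      linarith
    · exact ((if_neg hb).trans (if_neg hb).symm).le
  have hstep : ∀ a b t, Saturated d α a b → ¬ Acc (Saturated d α) a →
      ¬ Acc (Saturated d α) b → K ≤ t →
      M.laplacian (u a t) a ≤ M.laplacian (u b (t + d a b)) b := by
    intro a b t hab ha hb ht
    refine M.laplacian_le_of_saturated hd hα hle hab.1 (hκ a b hab.1.ne) hab.2
      (by rw [hu0 a _ ha, hu0 b _ hb]) fun x' y' c _ _ hc hc' => ?_
    by_cases hy : Acc (Saturated d α) y'
    · obtain ⟨hx', h1⟩ := acc_saturated_of_walk hle (fun a v => (hℓ v).2.1 a) c hc hy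
      rw [hc', hab.2, α.antisymm b y'] at h1
      rw [hupos a _ x' hx', hupos b _ y' hy]
      linarith
    · exact (hunonpos a t x' ht).trans (if_neg hy).ge
  obtain ⟨C, hC⟩ : ∃ C, ∀ a, C ≤ M.laplacian (u a K) a :=
    (Set.finite_range fun a => M.laplacian (u a K) a).bddBelow.imp fun C hC a => hC ⟨a, rfl⟩
  -- An inaccessible vertex has an inaccessible saturated predecessor. Each step back lowers `t` by
  -- at least `δ`, so the bound `C` holds for arbitrarily large `t`.
  have hind : ∀ n : ℕ, ∀ a, ¬ Acc (Saturated d α) a → C ≤ M.laplacian (u a (K + n * δ)) a := by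
    intro n
    induction n with
    | zero => intro a _; simpa using hC a
    | succ n ih =>
      intro b hb
      obtain ⟨a, hab, ha⟩ : ∃ a, Saturated d α a b ∧ ¬ Acc (Saturated d α) a := by
        by_contra! hcon
        exact hb ⟨b, hcon⟩
      refine (ih a ha).trans ((hstep a b _ hab ha hb ?_).trans (hanti b _ _ hb ?_))
      · have : 0 ≤ (n : ℝ) * δ := by positivity
        linarith
      · push_cast
        linarith [hδd a b hab.1]
  -- An accessible neighbour `z` alone pushes the Laplacian at `x` down to `-n * δ * M.p x z`, below
  -- `C` for this `n`.
  obtain ⟨n, hn⟩ := exists_nat_gt (-C / (M.p x z * δ))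
  have hpδ : 0 < M.p x z * δ := mul_pos hxz.2 hδ
  rw [div_lt_iff₀ hpδ] at hn
  have h1 := hind n x hx
  have hKn : K ≤ K + n * δ := by
    have : 0 ≤ (n : ℝ) * δ := by positivity
    linarith
  have h2 : M.laplacian (u x (K + n * δ)) x ≤ M.p x z * (u x (K + n * δ) z - 0) := by
    have := Finset.sum_le_sum_of_subset_of_nonneg (f := fun b =>
      -(M.p x b * (u x (K + n * δ) b - u x (K + n * δ) x))) (Finset.subset_univ {z})
      fun b _ _ => by
        rw [hu0 x _ hx, sub_zero, neg_nonneg]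
        exact mul_nonpos_of_nonneg_of_nonpos (M.nonneg x b) (hunonpos x _ b hKn)
    rw [Finset.sum_singleton, Finset.sum_neg_distrib, hu0 x _ hx] at this
    rw [laplacian, hu0 x _ hx]
    linarith
  rw [hupos x _ z hz, sub_zero] at h2
  have h3 : M.p x z * (α z x + ℓ z - (K + n * δ)) ≤ M.p x z * (-(n * δ)) :=
    mul_le_mul_of_nonneg_left (by linarith [hK (z, x)]) hxz.2.le
  linarith

/-- A harmonic one-form of norm one has a saturated edge ending at every vertex. -/
theorem exists_saturated (hd : IsPathDistance M.graph d)
    (hκ : ∀ x y, x ≠ y → 0 ≤ M.curvature d x y) (hα : α ∈ M.harmonicForms d)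
    (hle : ∀ a b, M.graph.Adj a b → α a b ≤ d a b) {x y : V} (hxy : Saturated d α x y) (v : V) :
    ∃ a, Saturated d α a v := by
  obtain ⟨w, hw⟩ := exists_not_acc_saturated hd hκ hα hle hxy
  have hv : ¬ Acc (Saturated d α) v :=
    M.forall_of_adj_closed (P := fun v => ¬ Acc (Saturated d α) v) hw
      (fun a b hab => not_acc_saturated_of_adj hd hκ hα hle hab) v
  by_contra! hcon
  exact hv ⟨v, fun a ha => absurd ha (hcon a)⟩

end MarkovChain

/-! ### Counting functionals. -/

section LinearAlgebra

variable {E : Type*} [AddCommGroup E] [Module ℝ E]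

/-- A finite set of non-zero functionals that is closed under negation and separates points has at
least `2 dim E` elements. -/
theorem two_mul_finrank_le_card_of_neg_mem (T : Finset (Module.Dual ℝ E))
    (hneg : ∀ φ ∈ T, -φ ∈ T) (h0 : (0 : Module.Dual ℝ E) ∉ T)
    (hsep : ∀ w : E, (∀ φ ∈ T, φ w = 0) → w = 0) :
    2 * Module.finrank ℝ E ≤ T.card := by
  classical
  have hspan : Submodule.span ℝ (T : Set (Module.Dual ℝ E)) = ⊤ := by
    rw [← Subspace.dualCoannihilator_dualAnnihilator_eq
      (W := Submodule.span ℝ (T : Set (Module.Dual ℝ E)))]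
    have : (Submodule.span ℝ (T : Set (Module.Dual ℝ E))).dualCoannihilator = ⊥ := by
      rw [eq_bot_iff]
      intro w hw
      rw [Submodule.mem_dualCoannihilator] at hw
      exact hsep w fun φ hφ => hw φ (Submodule.subset_span hφ)
    rw [this, Submodule.dualAnnihilator_bot]
  obtain ⟨b, hbT, hbspan, hli⟩ := exists_linearIndependent ℝ (T : Set (Module.Dual ℝ E))
  rw [hspan] at hbspan
  have hbfin : b.Finite := T.finite_toSet.subset hbT
  lift b to Finset (Module.Dual ℝ E) using hbfin
  have hcard : b.card = Module.finrank ℝ E := by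
    rw [← Subspace.dual_finrank_eq, ← finrank_top ℝ (Module.Dual ℝ E), ← hbspan]
    exact (finrank_span_finset_eq_card hli).symm
  -- `b` is a basis of the dual chosen inside `T`; independence keeps it disjoint from its negative.
  have hdisj : Disjoint b (b.image fun φ => -φ) := by
    rw [Finset.disjoint_left]
    intro φ hφ hφ'
    obtain ⟨ψ, hψ, hψφ⟩ := Finset.mem_image.1 hφ'
    have hne : ψ ≠ φ := by
      rintro rfl
      have : ψ = 0 := by
        have h2 : (2 : ℝ) • ψ = 0 := by
          rw [two_smul]
          nth_rewrite 1 [← hψφ]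
          simp
        simpa using h2
      exact h0 (this ▸ hbT hφ)
    have hpair := (LinearIndepOn.pair_iff (R := ℝ) id hne).1
      (LinearIndepOn.mono (s := (b : Set (Module.Dual ℝ E))) hli
        (Set.insert_subset hψ (Set.singleton_subset_iff.2 hφ)))
    exact one_ne_zero (hpair 1 1 (by simp [← hψφ])).1
  calc 2 * Module.finrank ℝ E = b.card + (b.image fun φ => -φ).card := by
        rw [Finset.card_image_of_injective _ neg_injective, hcard, two_mul]
    _ = (b ∪ b.image fun φ => -φ).card := (Finset.card_union_of_disjoint hdisj).symm
    _ ≤ T.card := Finset.card_le_card (Finset.union_subset (by exact_mod_cast hbT) (by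
        intro φ hφ
        obtain ⟨ψ, hψ, rfl⟩ := Finset.mem_image.1 hφ
        exact hneg ψ (hbT hψ)))

/-- If the largest absolute value among finitely many functionals is always attained with a
positive sign, then there are at least `2 dim E` of them. -/
theorem two_mul_finrank_le_card {ι : Type*} [Fintype ι] (e : ι → Module.Dual ℝ E)
    (h : ∀ w : E, w ≠ 0 → ∃ i, 0 < e i w ∧ ∀ j, |e j w| ≤ e i w) :
    2 * Module.finrank ℝ E ≤ Fintype.card ι := by
  classical
  let good : Finset ι → Prop := fun S =>
    ∀ w : E, w ≠ 0 → ∃ i ∈ S, 0 < e i w ∧ ∀ j, |e j w| ≤ e i w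
  -- In a minimal good set each `i` is the only member attaining the maximum at some `w`. Whichever
  -- `k` attains it at `-w` turns out to be the negative of `i`.
  obtain ⟨S, hS, hmin⟩ : ∃ S, good S ∧ ∀ i ∈ S, ¬ good (S.erase i) := by
    obtain ⟨S, hS⟩ := Set.Finite.exists_minimal (Set.toFinite {S | good S})
      ⟨Finset.univ, fun w hw => by simpa using h w hw⟩
    exact ⟨S, hS.prop, fun i hi hg =>
      Finset.notMem_erase i S (hS.le_of_le hg (Finset.erase_subset i S) hi)⟩
  have key : ∀ i ∈ S, e i ≠ 0 ∧ ∃ k ∈ S, e k = -e i := by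
    intro i hi
    obtain ⟨w, hw, hwS⟩ : ∃ w : E, w ≠ 0 ∧
        ∀ j ∈ S.erase i, ¬ (0 < e j w ∧ ∀ k, |e k w| ≤ e j w) := by
      have := hmin i hi
      simp only [good] at this
      push Not at this
      obtain ⟨w, hw, hw'⟩ := this
      refine ⟨w, hw, fun j hj hcon => ?_⟩
      obtain ⟨k, hk⟩ := hw' j hj hcon.1
      exact absurd (hcon.2 k) (not_le.2 hk)
    obtain ⟨i₀, hi₀, hpos, hmax⟩ := hS w hw
    obtain rfl : i₀ = i := by
      by_contra hne
      exact hwS i₀ (Finset.mem_erase.2 ⟨hne, hi₀⟩) ⟨hpos, hmax⟩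
    have hlt : ∀ j ∈ S, j ≠ i₀ → e j w < e i₀ w := by
      intro j hj hne
      by_contra! hge
      exact hwS j (Finset.mem_erase.2 ⟨hne, hj⟩)
        ⟨hpos.trans_le hge, fun k => (hmax k).trans hge⟩
    obtain ⟨k, hk, -, hkmax⟩ := hS (-w) (neg_ne_zero.2 hw)
    have hkw : e k w = -e i₀ w := by
      have h1 := hkmax i₀
      have h2 := hmax k
      rw [map_neg, map_neg, abs_neg, abs_of_pos hpos] at h1
      have := neg_abs_le (e k w)
      linarith
    refine ⟨fun h0 => by simp [h0] at hpos, k, hk, ?_⟩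
    -- For small `t > 0` the functional `e i₀` is still the unique maximiser at `w + t • v`, so it
    -- bounds `-e k` there. At `w` the two agree, so the bound passes to `v`; using `-v` as well
    -- gives equality.
    have hle : ∀ v : E, -e k v ≤ e i₀ v := by
      intro v
      have hev : ∀ᶠ t : ℝ in nhdsWithin 0 (Set.Ioi 0), ∀ j ∈ insert i₀ S,
          (j ≠ i₀ → e j w + t * e j v < e i₀ w + t * e i₀ v) ∧ 0 < e i₀ w + t * e i₀ v := by
        have hcont : ∀ j, Filter.Tendsto (fun t : ℝ => e j w + t * e j v)
            (nhdsWithin 0 (Set.Ioi 0)) (nhds (e j w)) := by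
          intro j
          have : Continuous fun t : ℝ => e j w + t * e j v := by fun_prop
          simpa using this.continuousWithinAt (s := Set.Ioi 0) (x := 0) |>.tendsto
        rw [Filter.eventually_all_finset]
        intro j hj
        refine Filter.Eventually.and ?_ ((hcont i₀).eventually_const_lt hpos)
        by_cases hji : j = i₀
        · exact Filter.Eventually.of_forall fun t h => absurd hji h
        · exact ((hcont j).eventually_lt (hcont i₀)
            (hlt j ((Finset.mem_insert.1 hj).resolve_left hji) hji)).mono fun t h _ => h
      obtain ⟨t, ht, htpos⟩ := (hev.and self_mem_nhdsWithin).exists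
      have hne : w + t • v ≠ 0 := by
        intro h0
        have h1 := (ht i₀ (Finset.mem_insert_self _ _)).2
        have h2 : e i₀ (w + t • v) = 0 := by rw [h0, map_zero]
        simp only [map_add, map_smul, smul_eq_mul] at h2
        linarith
      obtain ⟨j, hj, -, hjmax⟩ := hS _ hne
      obtain rfl : j = i₀ := by
        by_contra hji
        have h1 := (ht j (Finset.mem_insert_of_mem hj)).1 hji
        have h2 := (le_abs_self _).trans (hjmax i₀)
        simp only [map_add, map_smul, smul_eq_mul] at h2
        linarith
      have h2 := (neg_le_abs _).trans (hjmax k)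
      simp only [map_add, map_smul, smul_eq_mul, hkw] at h2
      have : t * -e k v ≤ t * e j v := by linarith
      exact le_of_mul_le_mul_left this htpos
    ext v
    have h1 := hle v
    have h2 := hle (-v)
    rw [map_neg, map_neg] at h2
    rw [LinearMap.neg_apply]
    linarith
  refine (two_mul_finrank_le_card_of_neg_mem (S.image e) ?_ ?_ ?_).trans
    (Finset.card_image_le.trans (Finset.card_le_univ S))
  · intro φ hφ
    obtain ⟨i, hi, rfl⟩ := Finset.mem_image.1 hφ
    obtain ⟨k, hk, hki⟩ := (key i hi).2
    exact Finset.mem_image.2 ⟨k, hk, hki⟩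
  · intro h0
    obtain ⟨i, hi, hi0⟩ := Finset.mem_image.1 h0
    exact (key i hi).1 hi0
  · intro w hw
    by_contra hne
    obtain ⟨i, hi, hpos, -⟩ := hS w hne
    exact hpos.ne' (hw _ (Finset.mem_image_of_mem e hi))

end LinearAlgebra

instance {V : Type*} [Finite V] (G : SimpleGraph V) : FiniteDimensional ℝ (OneForm G) :=
  inferInstanceAs (FiniteDimensional ℝ (oneForms G))

/-! ### Hodge decomposition and the bound by the minimal degree. -/

namespace MarkovChain

variable {V : Type*} [Fintype V] (M : MarkovChain V)

theorem deltaStar_add (α β : OneForm M.graph) (x : V) :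
    M.deltaStar (α + β) x = M.deltaStar α x + M.deltaStar β x := by
  simp [deltaStar, mul_add, Finset.sum_add_distrib]

theorem deltaStar_delta0 (f : V → ℝ) (x : V) :
    M.deltaStar (delta0 M.graph f) x = -M.laplacian f x := by
  rw [deltaStar, laplacian, ← Finset.sum_neg_distrib]
  refine Finset.sum_congr rfl fun y _ => ?_
  change M.p x y * gradForm M.graph f x y = _
  rw [gradForm_apply]
  split_ifs with h
  · ring
  · by_cases hxy : x = y
    · simp [hxy]
    · simp [M.eq_zero_of_not_adj hxy h]

/-- A function with constant Laplacian is constant. -/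
theorem eq_of_laplacian_const {f : V → ℝ} {c : ℝ} (h : ∀ x, M.laplacian f x = c) (x y : V) :
    f x = f y := by
  obtain ⟨a, -, ha⟩ := Finset.exists_max_image Finset.univ f ⟨x, Finset.mem_univ x⟩
  obtain ⟨b, -, hb⟩ := Finset.exists_min_image Finset.univ f ⟨x, Finset.mem_univ x⟩
  have hc : 0 ≤ c := (M.laplacian_nonneg_of_min fun z => hb z (Finset.mem_univ z)).trans (h b).le
  have hall : ∀ z, f z = f a := M.forall_of_adj_closed (P := fun z => f z = f a) rfl
    fun z w hzw hz => hz ▸ M.eq_of_laplacian_nonneg (fun t => hz ▸ ha t (Finset.mem_univ t))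
      (hc.trans (h z).ge) hzw
  rw [hall x, hall y]

/-- Every function is the sum of a constant and a Laplacian. -/
theorem exists_laplacian_add_const_eq [Nonempty V] (g : V → ℝ) :
    ∃ (f : V → ℝ) (c : ℝ), ∀ x, M.laplacian f x + c = g x := by
  obtain ⟨x₀⟩ := ‹Nonempty V›
  -- Adding the value at `x₀` removes the constants from the kernel, so `T` is injective and hence
  -- surjective.
  let T : (V → ℝ) →ₗ[ℝ] (V → ℝ) :=
    { toFun := fun f x => M.laplacian f x + f x₀
      map_add' := fun f g => by
        ext x
        simp only [laplacian_add, Pi.add_apply]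
        ring
      map_smul' := fun r f => by
        ext x
        simp only [laplacian_smul, Pi.smul_apply, smul_eq_mul, RingHom.id_apply]
        ring }
  have hT : ∀ f x, T f x = M.laplacian f x + f x₀ := fun _ _ => rfl
  have hinj : Function.Injective T := by
    rw [injective_iff_map_eq_zero]
    intro f hf
    have h0 : ∀ x, M.laplacian f x + f x₀ = 0 := fun x => by rw [← hT, hf]; rfl
    have hconst := M.eq_of_laplacian_const (f := f) (c := -f x₀) fun x => by linarith [h0 x]
    have hL : M.laplacian f x₀ = 0 := by simp [laplacian, fun y => hconst y x₀]
    ext x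
    rw [hconst x x₀, Pi.zero_apply]
    linarith [h0 x₀]
  obtain ⟨f, hf⟩ := LinearMap.injective_iff_surjective.1 hinj g
  exact ⟨f, f x₀, fun x => by rw [← hT, hf]⟩

theorem harmonicForms_le_ker (d : V → V → ℝ) :
    M.harmonicForms d ≤ LinearMap.ker (delta1 M.graph d) := fun _ hα => hα.1

/-- Hodge decomposition: every closed form is cohomologous to a unique harmonic form. -/
theorem isCompl_range_delta0_harmonicForms [Nonempty V] (d : V → V → ℝ) :
    IsCompl ((LinearMap.range (delta0 M.graph)).submoduleOf (LinearMap.ker (delta1 M.graph d)))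
      ((M.harmonicForms d).submoduleOf (LinearMap.ker (delta1 M.graph d))) := by
  constructor
  · rw [Submodule.disjoint_def]
    rintro ⟨α, hα⟩ h1 h2
    obtain ⟨f, rfl⟩ : ∃ f, delta0 M.graph f = α := h1
    obtain ⟨-, c, hc⟩ : delta0 M.graph f ∈ M.harmonicForms d := h2
    have hconst := M.eq_of_laplacian_const (f := f) (c := -c) fun x => by
      rw [← hc x, deltaStar_delta0, neg_neg]
    rw [Submodule.mk_eq_zero]
    ext x y
    change gradForm M.graph f x y = 0
    rw [gradForm_apply, hconst x y, sub_self, ite_self]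
  · rw [codisjoint_iff, eq_top_iff]
    rintro ⟨α, hα⟩ -
    obtain ⟨f, c, hf⟩ := M.exists_laplacian_add_const_eq (M.deltaStar α)
    have hdf : delta0 M.graph f ∈ LinearMap.ker (delta1 M.graph d) := delta1_delta0 M.graph d f
    rw [Submodule.mem_sup]
    -- The gradient is added rather than subtracted because `deltaStar` of `delta0 f` is minus the
    -- Laplacian.
    refine ⟨-⟨_, hdf⟩, Submodule.neg_mem _ ⟨f, rfl⟩, ⟨α, hα⟩ + ⟨_, hdf⟩, ?_, by abel⟩
    refine ⟨Submodule.add_mem _ hα hdf, c, fun x => ?_⟩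
    change M.deltaStar (α + delta0 M.graph f) x = c
    rw [deltaStar_add, deltaStar_delta0]
    linarith [hf x]

theorem betti1_eq_finrank_harmonicForms [Nonempty V] (d : V → V → ℝ) :
    betti1 M.graph d = Module.finrank ℝ (M.harmonicForms d) :=
  (Submodule.quotientEquivOfIsCompl _ _ (M.isCompl_range_delta0_harmonicForms d)).finrank_eq.trans
    (Submodule.submoduleOfEquivOfLe (M.harmonicForms_le_ker d)).finrank_eq

/-- If the curvature is non-negative, then a non-zero harmonic form attains its norm, with a
positive sign, at an edge ending at any given vertex. -/
theorem exists_adj_div_eq_norm {d : V → V → ℝ} (hd : IsPathDistance M.graph d)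
    (hκ : ∀ x y, x ≠ y → 0 ≤ M.curvature d x y) {α : OneForm M.graph} (hα : α ∈ M.harmonicForms d)
    (hne : α ≠ 0) (v : V) :
    ∃ w, M.graph.Adj v w ∧ 0 < α w v / d w v ∧ ∀ a b, |α a b / d a b| ≤ α w v / d w v := by
  obtain ⟨a₀, b₀, h₀⟩ : ∃ a b, α a b ≠ 0 := by
    by_contra! h
    exact hne (OneForm.ext h)
  have hadj : ∀ {a b}, α a b ≠ 0 → M.graph.Adj a b := fun h =>
    by_contra fun hn => h (α.apply_eq_zero hn)
  -- All ordered pairs may be used: non-adjacent and diagonal pairs give 0, and antisymmetry makes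
  -- the maximum one of absolute values.
  obtain ⟨q, -, hq⟩ := Finset.exists_max_image Finset.univ
    (fun q : V × V => α q.1 q.2 / d q.1 q.2) ⟨(a₀, b₀), Finset.mem_univ _⟩
  set m := α q.1 q.2 / d q.1 q.2 with hm
  have hmax : ∀ a b, |α a b / d a b| ≤ m := by
    intro a b
    refine abs_le'.2 ⟨hq (a, b) (Finset.mem_univ _), ?_⟩
    have := hq (b, a) (Finset.mem_univ _)
    dsimp only at this
    rwa [α.antisymm b a, hd.symm b a, neg_div] at this
  have hmpos : 0 < m := lt_of_lt_of_le
    (abs_pos.2 (div_ne_zero h₀ (hd.pos (hadj h₀).ne).ne')) (hmax a₀ b₀)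
  have hq0 : α q.1 q.2 ≠ 0 := fun h => by
    rw [hm, h, zero_div] at hmpos
    exact lt_irrefl _ hmpos
  have hsat : ∀ {a b}, M.graph.Adj a b →
      ((m⁻¹ • α) a b = d a b ↔ α a b / d a b = m) := by
    intro a b hab
    rw [OneForm.smul_apply, inv_mul_eq_iff_eq_mul₀ hmpos.ne', div_eq_iff (hd.pos hab.ne).ne']
  obtain ⟨w, hw⟩ := exists_saturated hd hκ ((M.harmonicForms d).smul_mem m⁻¹ hα)
    (fun a b hab => by
      rw [OneForm.smul_apply, inv_mul_le_iff₀ hmpos, ← div_le_iff₀ (hd.pos hab.ne)]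
      exact (le_abs_self _).trans (hmax a b))
    (x := q.1) (y := q.2) ⟨hadj hq0, (hsat (hadj hq0)).2 rfl⟩ v
  have hwm := (hsat hw.1).1 hw.2
  exact ⟨w, hw.1.symm, hwm ▸ hmpos, fun a b => hwm ▸ hmax a b⟩

/-- There is one functional for each edge into a vertex of minimal degree; `exists_adj_div_eq_norm`
is the hypothesis of the counting lemma. -/
theorem two_mul_finrank_harmonicForms_le_degMin [Nonempty V] {d : V → V → ℝ}
    (hd : IsPathDistance M.graph d) (hκ : ∀ x y, x ≠ y → 0 ≤ M.curvature d x y) :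
    2 * Module.finrank ℝ (M.harmonicForms d) ≤ M.degMin := by
  classical
  obtain ⟨v, hv⟩ : ∃ v, M.degMin = Fintype.card (M.graph.neighborSet v) := by
    obtain ⟨v, hv⟩ := M.graph.exists_minimal_degree_vertex
    refine ⟨v, ?_⟩
    rw [SimpleGraph.card_neighborSet_eq_degree, ← hv, degMin]
  rw [hv]
  let e : M.graph.neighborSet v → Module.Dual ℝ (M.harmonicForms d) := fun w =>
    { toFun := fun α => α.1 w.1 v / d w.1 v
      map_add' := fun α β => add_div _ _ _
      map_smul' := fun r α => mul_div_assoc _ _ _ }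
  refine two_mul_finrank_le_card e fun α hα => ?_
  obtain ⟨w, hw, hpos, hmax⟩ := M.exists_adj_div_eq_norm hd hκ α.2
    (fun h => hα (Subtype.ext h)) v
  exact ⟨⟨w, hw⟩, hpos, fun j => hmax j.1 v⟩

end MarkovChain

end OllivierBetti
end

theorem mainTheorem7 {V : Type*} [Fintype V] [Nonempty V] (M : OllivierBetti.MarkovChain V)
    (d : V → V → ℝ) (hd : OllivierBetti.IsPathDistance M.graph d) :
    OllivierBetti.betti1 M.graph d = Module.finrank ℝ (M.harmonicForms d) ∧
      ((∀ x y : V, x ≠ y → 0 ≤ M.curvature d x y) →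
        (OllivierBetti.betti1 M.graph d : ℝ) ≤ (M.degMin : ℝ) / 2) := by
  refine ⟨M.betti1_eq_finrank_harmonicForms d, fun hκ => ?_⟩
  rw [M.betti1_eq_finrank_harmonicForms d, le_div_iff₀ two_pos, mul_comm]
  exact_mod_cast M.two_mul_finrank_harmonicForms_le_degMin hd hκ
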